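/- Notation. For $f:\mathbb{R}^n\to\overline{\mathbb{R}}$, $\partial f(x)$ denotes the limiting (Mordukhovich) subdifferential at a point where $f$ is finite, and for a set $C$, $N_C$ denotes the limiting normal cone. The function $f$ is *prox-regular at $\bar x$ for $\bar w\in\partial f(\bar x)$ with respect to $\bar\epsilon>0$ and $\rho\ge 0$* if $f$ is finite and locally l.s.c. at $\bar x$ and $$f(x')\ \ge\ f(x)+\langle w,x'-x\rangle-\tfrac{\rho}{2}\|x'-x\|^2\qquad\text{for all } x' \text{ with } \|x'-\bar x\|\le\bar\epsilon$$ whenever $w\in\partial f(x)$, $\|w-\bar w\|<\bar\epsilon$, $\|x-\bar x\|<\bar\epsilon$ and $f(x)<f(\bar x)+\bar\epsilon$. A set $C$ is prox-regular at $\bar x\in C$ for $\bar w\in N_C(\bar x)$ if its indicator function is prox-regular at $\bar x$ for $\bar w$ (with respect to some constants). The function $f$ is *properly prox-regular at $\bar x$ with respect to $\bar\epsilon$ and $\rho$* if, for every $g\in\partial f(\bar x)$, $f$ is prox-regular at $\bar x$ for $g$ with respect to these $\bar\epsilon$ and $\rho$, and, for every $(g,-1)\in N_{\operatorname{epi} f}(\bar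 x,f(\bar x))$, the set $\operatorname{epi} f$ is prox-regular at $(\bar x,f(\bar x))$ for $(g,-1)$. Theorem. Let $f:\mathbb{R}^n\to\overline{\mathbb{R}}$ be proper, lower semicontinuous, and properly prox-regular at $\bar x$ with respect to $\bar\epsilon$ and $\rho$, where $\rho\in(0,2)$, and let $0<\epsilon<\bar\epsilon$. Let $\mathcal V=\operatorname{span}(\partial f(\bar x)-\tilde g)$, where $\tilde g\in\partial f(\bar x)$ is arbitrary, let $\mathcal U=\mathcal V^\perp$, and for $x\in\mathbb{R}^n$ write $x_u$ and $x_v$ for the orthogonal projections of $x$ onto $\mathcal U$ and $\mathcal V$. Let $\bar g$ belong to the $\epsilon$-relative interior of $\partial f(\bar x)$, i.e. $\bar g+w\in\partial f(\bar x)$ for all $w\in\mathcal V$ with $\|w\|<\epsilon$, and define the local $\mathcal U$-Lagrangian $$L_\epsilon(u;\bar g_v)=\inf\{f(\bar x+u+v)-\langle\bar g_v,v\rangle:\ v\in\mathcal V,\ \|v\|\le\epsilon\},\qquad u\in\mathcal U.$$ Then $L_\epsilon(\cdot;\bar g_v)$ is strictly differentiable at $0$ with gradient $\nabla L_\epsilon(0;\bar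 g_v)=\bar g_u$; that is, $L_\epsilon(\cdot;\bar g_v)$ is finite near $0$ in $\mathcal U$ and $$L_\epsilon(u';\bar g_v)=L_\epsilon(u;\bar g_v)+\langle\bar g_u,u'-u\rangle+o(\|u'-u\|)\qquad\text{as } u,u'\to 0 \text{ in } \mathcal U.$$ -/

import Mathlib

open Filter Topology

noncomputable section

namespace ULag

section Variational

variable {E : Type*} [NormedAddCommGroup E] [InnerProductSpace ℝ E]

/-- An extended-real-valued function is finite at `x`. -/
def FiniteAt (f : E → EReal) (x : E) : Prop := f x ≠ ⊥ ∧ f x ≠ ⊤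

/-- `f` is proper: it never takes the value `-∞` and is not identically `+∞`. -/
def IsProper (f : E → EReal) : Prop := (∀ x, f x ≠ ⊥) ∧ ∃ x, f x ≠ ⊤

/-- The regular (Fréchet) subdifferential: `f` is finite at `x` and
`f y ≥ f x + ⟨v, y - x⟩ + o(‖y - x‖)` as `y → x`. -/
def regSubdiff (f : E → EReal) (x : E) : Set E :=
  {v | FiniteAt f x ∧ ∀ δ : ℝ, 0 < δ →
    ∀ᶠ y in 𝓝 x, f x + ((inner ℝ v (y - x) - δ * ‖y - x‖ : ℝ) : EReal) ≤ f y}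

/-- The limiting subdifferential `∂f(x)`: limits of regular subgradients at points `xₖ → x` with
`f xₖ → f x`. -/
def limSubdiff (f : E → EReal) (x : E) : Set E :=
  {v | FiniteAt f x ∧ ∃ (xs vs : ℕ → E),
    Tendsto xs atTop (𝓝 x) ∧ Tendsto (fun k => f (xs k)) atTop (𝓝 (f x)) ∧
    (∀ k, vs k ∈ regSubdiff f (xs k)) ∧ Tendsto vs atTop (𝓝 v)}

/-- The regular normal cone of `C` at `x` (empty if `x ∉ C`):
`⟨w, y - x⟩ ≤ o(‖y - x‖)` as `y → x` within `C`. -/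
def regNormalCone (C : Set E) (x : E) : Set E :=
  {w | x ∈ C ∧ ∀ δ : ℝ, 0 < δ → ∀ᶠ y in 𝓝[C] x, inner ℝ w (y - x) ≤ δ * ‖y - x‖}

/-- The limiting normal cone `N_C(x)` (empty if `x ∉ C`). -/
def limNormalCone (C : Set E) (x : E) : Set E :=
  {w | x ∈ C ∧ ∃ (xs ws : ℕ → E),
    Tendsto xs atTop (𝓝 x) ∧ (∀ k, ws k ∈ regNormalCone C (xs k)) ∧ Tendsto ws atTop (𝓝 w)}

open Classical in
/-- The indicator function of `C`: `0` on `C` and `+∞` elsewhere. -/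
def indicatorFun (C : Set E) (x : E) : EReal := if x ∈ C then 0 else ⊤

/-- `f` is locally lower semicontinuous at `x`: for some `δ > 0`, all the sets
`{y ∈ B(x, δ) : f y ≤ α}` with `α ≤ f x + δ` are closed. -/
def LocallyLSCAt (f : E → EReal) (x : E) : Prop :=
  ∃ δ : ℝ, 0 < δ ∧ ∀ α : EReal, α ≤ f x + (δ : EReal) →
    IsClosed {y | y ∈ Metric.closedBall x δ ∧ f y ≤ α}

/-- `f` is prox-regular at `xbar` for `vbar` with respect to the constants `ε` and `ρ`. -/
def ProxRegularWith (f : E → EReal) (xbar vbar : E) (ε ρ : ℝ) : Prop :=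
  0 < ε ∧ 0 ≤ ρ ∧ FiniteAt f xbar ∧ LocallyLSCAt f xbar ∧ vbar ∈ limSubdiff f xbar ∧
    ∀ x v : E, v ∈ limSubdiff f x → ‖v - vbar‖ < ε → ‖x - xbar‖ < ε →
      f x < f xbar + (ε : EReal) →
      ∀ x' ∈ Metric.closedBall xbar ε,
        f x + ((inner ℝ v (x' - x) - ρ / 2 * ‖x' - x‖ ^ 2 : ℝ) : EReal) ≤ f x'

/-- A set `C` is prox-regular at `xbar ∈ C` for `wbar ∈ N_C(xbar)` if its indicator function is
prox-regular at `xbar` for `wbar` (with respect to some constants). -/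
def SetProxRegular (C : Set E) (xbar wbar : E) : Prop :=
  xbar ∈ C ∧ wbar ∈ limNormalCone C xbar ∧
    ∃ ε ρ : ℝ, ProxRegularWith (indicatorFun C) xbar wbar ε ρ

/-- The epigraph of `f`, in the Hilbert space `E × ℝ`. -/
def epigraph (f : E → EReal) : Set (WithLp 2 (E × ℝ)) := {p | f p.fst ≤ (p.snd : EReal)}

/-- `f` is properly prox-regular at `xbar` with respect to `ε` and `ρ`: for every `g ∈ ∂f(xbar)`
the function `f` is prox-regular at `xbar` for `g` with respect to `ε` and `ρ` (the same constants
for all `g`), and for every normal `(g, -1)` to `epi f` at `(xbar, f xbar)` the set `epi f` is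
prox-regular at `(xbar, f xbar)` for `(g, -1)`. -/
def ProperlyProxRegularWith (f : E → EReal) (xbar : E) (ε ρ : ℝ) : Prop :=
  (∀ g ∈ limSubdiff f xbar, ProxRegularWith f xbar g ε ρ) ∧
  ∀ g : E,
    WithLp.toLp 2 (g, (-1 : ℝ)) ∈
        limNormalCone (epigraph f) (WithLp.toLp 2 (xbar, (f xbar).toReal)) →
      SetProxRegular (epigraph f) (WithLp.toLp 2 (xbar, (f xbar).toReal))
        (WithLp.toLp 2 (g, (-1 : ℝ)))

/-- `φ` is strictly differentiable at `x` with gradient `v`: it is finite near `x` and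
`φ y' = φ y + ⟨v, y' - y⟩ + o(‖y' - y‖)` as `y, y' → x`. -/
def StrictlyDifferentiableWithGradient (φ : E → EReal) (v x : E) : Prop :=
  (∀ᶠ y in 𝓝 x, FiniteAt φ y) ∧
    HasStrictFDerivAt (fun y => (φ y).toReal) (innerSL ℝ v) x

end Variational

section UV

variable {n : ℕ}

/-- `V(xbar)`, the linear span of the differences of elements of `∂f(xbar)`. -/
def spaceV (f : EuclideanSpace ℝ (Fin n) → EReal) (xbar : EuclideanSpace ℝ (Fin n)) :
    Submodule ℝ (EuclideanSpace ℝ (Fin n)) :=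
  vectorSpan ℝ (limSubdiff f xbar)

/-- `V(xbar) = span (∂f(xbar) - gt)` for an arbitrary subgradient `gt`. -/
theorem spaceV_eq (f : EuclideanSpace ℝ (Fin n) → EReal) (xbar gt : EuclideanSpace ℝ (Fin n))
    (hgt : gt ∈ limSubdiff f xbar) :
    spaceV f xbar = Submodule.span ℝ ((fun g => g - gt) '' limSubdiff f xbar) :=
  vectorSpan_eq_span_vsub_set_right ℝ hgt

/-- `U(xbar)`, the orthogonal complement of `V(xbar)`. -/
def spaceU (f : EuclideanSpace ℝ (Fin n) → EReal) (xbar : EuclideanSpace ℝ (Fin n)) :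
    Submodule ℝ (EuclideanSpace ℝ (Fin n)) :=
  (spaceV f xbar)ᗮ

/-- The `ε`-relative interior of `∂f(xbar)`: the vectors `g` such that `g` plus the open
`ε`-ball of `V(xbar)` is contained in `∂f(xbar)`. -/
def epsRelInterior (f : EuclideanSpace ℝ (Fin n) → EReal) (xbar : EuclideanSpace ℝ (Fin n))
    (ε : ℝ) : Set (EuclideanSpace ℝ (Fin n)) :=
  {g | ∀ w ∈ spaceV f xbar, ‖w‖ < ε → g + w ∈ limSubdiff f xbar}

/-- The local `U`-Lagrangian
`L_ε(u; gv) = inf {f (xbar + u + v) - ⟨gv, v⟩ : v ∈ V, ‖v‖ ≤ ε}`, for `u ∈ U`. -/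
def uLagrangian (f : EuclideanSpace ℝ (Fin n) → EReal) (xbar : EuclideanSpace ℝ (Fin n))
    (ε : ℝ) (gv : spaceV f xbar) (u : spaceU f xbar) : EReal :=
  ⨅ v ∈ Metric.closedBall (0 : spaceV f xbar) ε,
    f (xbar + (u : EuclideanSpace ℝ (Fin n)) + (v : EuclideanSpace ℝ (Fin n))) -
      ((inner ℝ gv v : ℝ) : EReal)

end UV

end ULag

end

noncomputable section

namespace ULag

/-! Let `F` be `f` translated to `xbar`, minus its value there and minus `⟨gbar, ·⟩`. Then `F 0 =
0`, and `L_ε` is `φ u = inf_v F (u + v)` plus an affine function with gradient `gbar_u`. It thus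
suffices that, for each `δ > 0`, `φ` is finite and `δ`-Lipschitz near `0`.

Two facts give this. Since `gbar` lies well inside `∂f(xbar)`, prox-regularity makes `F` grow
linearly along `V` (`tilt_growth`). Since `∂F(0) ⊆ V`, no regular subgradient of `F` near `0` lies
in `U` with norm `δ` (`regSubdiff_norm_ne_near_zero`). Now minimize `F (y + v) + δ‖y - b‖` over a
compact box. Growth puts the minimizer in the interior; if `y ≠ b` it would yield such a forbidden
subgradient. So `y = b`, and comparison with any near-minimizer at `a` bounds `φ b` by `φ a + δ‖b -
a‖` (`exists_le_add_of_growth`). -/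

theorem ereal_add_coe_le_iff (a b : EReal) (r : ℝ) :
    a + (r : EReal) ≤ b ↔ a ≤ b + ((-r : ℝ) : EReal) := by
  induction a <;> induction b <;> norm_cast <;>
    simp [← sub_eq_add_neg, le_sub_iff_add_le, -EReal.coe_sub]

theorem lowerSemicontinuous_add_coe {X : Type*} [TopologicalSpace X] {f : X → EReal} {g : X → ℝ}
    (hf : LowerSemicontinuous f) (hg : Continuous g) :
    LowerSemicontinuous fun x => f x + (g x : EReal) :=
  hf.add' (continuous_coe_real_ereal.comp hg).lowerSemicontinuous fun _ =>
    EReal.continuousAt_add (Or.inr (EReal.coe_ne_bot _)) (Or.inr (EReal.coe_ne_top _))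

/-! ### Penalized minimization and regular subgradients in `U` -/

section Abstract

variable {E : Type*} [NormedAddCommGroup E] [InnerProductSpace ℝ E]

/-- The right side equals `(‖w'‖² - ‖w‖²) / (2‖w‖)`, so this is `(‖w'‖ - ‖w‖)² ≥ 0`. It bounds the
penalty to first order with a quadratic error. -/
theorem norm_sub_norm_le_inner_div (w w' : E) (hw : w ≠ 0) :
    ‖w'‖ - ‖w‖ ≤ inner ℝ w (w' - w) / ‖w‖ + ‖w' - w‖ ^ 2 / (2 * ‖w‖) := by
  have h0 : 0 < ‖w‖ := norm_pos_iff.2 hw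
  have h1 : ‖w'‖ ^ 2 = ‖w‖ ^ 2 + 2 * inner ℝ w (w' - w) + ‖w' - w‖ ^ 2 := by
    have := norm_add_sq_real w (w' - w)
    rwa [add_sub_cancel] at this
  have h2 : inner ℝ w (w' - w) / ‖w‖ + ‖w' - w‖ ^ 2 / (2 * ‖w‖)
      = (‖w'‖ ^ 2 - ‖w‖ ^ 2) / (2 * ‖w‖) := by
    rw [h1]; field_simp; ring
  rw [h2, le_div_iff₀ (by positivity)]
  nlinarith [sq_nonneg (‖w'‖ - ‖w‖)]

/-- A local minimizer of `F + δ * dist (P ·) b`, with `P` the projection onto `U`, has a regular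
subgradient in `U` of norm `δ`, unless its projection is `b`. -/
theorem mem_regSubdiff_of_isLocalMin_add_norm (F : E → EReal) (U : Submodule ℝ E)
    [U.HasOrthogonalProjection] {x b : E} (hb : b ∈ U) {δ : ℝ} (hδ : 0 < δ)
    (hx : FiniteAt F x) (hne : U.starProjection x - b ≠ 0)
    (hmin : ∀ᶠ z in 𝓝 x, F x + ((δ * ‖U.starProjection x - b‖ : ℝ) : EReal) ≤
      F z + ((δ * ‖U.starProjection z - b‖ : ℝ) : EReal)) :
    -(δ / ‖U.starProjection x - b‖) • (U.starProjection x - b) ∈ regSubdiff F x := by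
  set w := U.starProjection x - b with hw
  have hwU : w ∈ U := U.sub_mem (U.starProjection_apply_mem x) hb
  have h0 : 0 < ‖w‖ := norm_pos_iff.2 hne
  refine ⟨hx, fun η hη => ?_⟩
  -- This radius makes the quadratic error at most `η‖z - x‖`.
  have hball : ∀ᶠ z in 𝓝 x, ‖z - x‖ < 2 * ‖w‖ * η / δ := by
    have := Metric.ball_mem_nhds x (show 0 < 2 * ‖w‖ * η / δ by positivity)
    filter_upwards [this] with z hz
    rwa [← dist_eq_norm]
  filter_upwards [hmin, hball] with z hz hzx
  set w' := U.starProjection z - b with hw'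
  have hdiff : w' - w = U.starProjection (z - x) := by rw [map_sub, hw, hw']; abel
  have hinner : inner ℝ w (w' - w) = inner ℝ w (z - x) := by
    rw [hdiff, ← Submodule.inner_starProjection_left_eq_right,
      Submodule.starProjection_eq_self_iff.2 hwU]
  have hnorm : ‖w' - w‖ ≤ ‖z - x‖ := hdiff ▸ U.norm_starProjection_apply_le _
  have hkey := norm_sub_norm_le_inner_div w w' hne
  rw [hinner] at hkey
  have hsq : δ * (‖w' - w‖ ^ 2 / (2 * ‖w‖)) ≤ η * ‖z - x‖ := by
    have : ‖w' - w‖ ^ 2 ≤ ‖z - x‖ * (2 * ‖w‖ * η / δ) := by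
      nlinarith [norm_nonneg (w' - w), norm_nonneg (z - x)]
    calc δ * (‖w' - w‖ ^ 2 / (2 * ‖w‖)) ≤ δ * (‖z - x‖ * (2 * ‖w‖ * η / δ) / (2 * ‖w‖)) := by
          gcongr
      _ = η * ‖z - x‖ := by field_simp
  have hreal : inner ℝ (-(δ / ‖w‖) • w) (z - x) - η * ‖z - x‖ ≤ δ * ‖w‖ - δ * ‖w'‖ := by
    rw [real_inner_smul_left]
    have : -(δ / ‖w‖) * inner ℝ w (z - x) = - (δ * (inner ℝ w (z - x) / ‖w‖)) := by ring
    rw [this]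
    nlinarith [mul_le_mul_of_nonneg_left hkey hδ.le]
  rw [← neg_neg (δ * ‖w'‖), ← ereal_add_coe_le_iff, add_assoc, ← EReal.coe_add] at hz
  refine le_trans ?_ hz
  gcongr
  linarith

/-- Otherwise, compactness of the sphere gives a limiting subgradient at `0` of norm `δ` in `V ∩ Vᗮ
= 0`. -/
theorem regSubdiff_norm_ne_near_zero [FiniteDimensional ℝ E] {F : E → EReal} (hF : LowerSemicontinuous F)
    (hF0 : F 0 = 0) {V : Submodule ℝ E} (hV : limSubdiff F 0 ⊆ V) {δ : ℝ} (hδ : 0 < δ) :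
    ∃ η : ℝ, 0 < η ∧ ∀ x, ‖x‖ < η → F x < (η : EReal) → ∀ s ∈ regSubdiff F x, s ∈ Vᗮ →
      ‖s‖ ≠ δ := by
  by_contra! hcon
  have hpos : ∀ k : ℕ, (0 : ℝ) < 1 / ((k : ℝ) + 1) := fun k => Nat.one_div_pos_of_nat
  choose xs hx hFx ss hss hsV hsn using fun k : ℕ => hcon _ (hpos k)
  have hlim : Tendsto (fun k : ℕ => 1 / ((k : ℝ) + 1)) atTop (𝓝 0) :=
    tendsto_one_div_add_atTop_nhds_zero_nat
  have hx0 : Tendsto xs atTop (𝓝 0) :=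
    squeeze_zero_norm (fun k => (hx k).le) hlim
  have hF0' : Tendsto (fun k => F (xs k)) atTop (𝓝 0) := by
    refine tendsto_order.2 ⟨fun a ha => ?_, fun a ha => ?_⟩
    · exact hx0.eventually (hF 0 a (show a < F 0 by rwa [hF0]))
    · have : Tendsto (fun k : ℕ => ((1 / ((k : ℝ) + 1) : ℝ) : EReal)) atTop (𝓝 0) := by
        rw [← EReal.coe_zero]
        exact (continuous_coe_real_ereal.tendsto 0).comp hlim
      filter_upwards [this.eventually (gt_mem_nhds ha)] with k hk
      exact (hFx k).trans hk
  obtain ⟨s, hs, φ, hφ, hφs⟩ := (isCompact_sphere (0 : E) δ).tendsto_subseq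
    (fun k => mem_sphere_zero_iff_norm.2 (hsn k))
  have hsV' : s ∈ Vᗮ := V.isClosed_orthogonal.mem_of_tendsto hφs
    (Eventually.of_forall fun k => hsV (φ k))
  have hsmem : s ∈ limSubdiff F 0 := by
    refine ⟨by simp [FiniteAt, hF0], xs ∘ φ, ss ∘ φ, hx0.comp hφ.tendsto_atTop, ?_,
      fun k => hss (φ k), hφs⟩
    rw [hF0]
    exact hF0'.comp hφ.tendsto_atTop
  have : s = 0 := inner_self_eq_zero.1 (V.inner_right_of_mem_orthogonal (hV hsmem) hsV')
  rw [this] at hs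
  simp only [mem_sphere_iff_norm, sub_self, norm_zero] at hs
  exact hδ.ne hs

/-- Calmness of `u ↦ inf_v F (u + v)` with arbitrarily small modulus, in terms of near
minimizers. -/
theorem exists_le_add_of_growth [FiniteDimensional ℝ E] {F : E → EReal}
    (hF : LowerSemicontinuous F) (hF0 : F 0 = 0) {V : Submodule ℝ E}
    (hV : limSubdiff F 0 ⊆ V)
    {ε κ ρ r₀ : ℝ} (hε : 0 < ε) (hκ : 0 < κ) (hr₀ : 0 < r₀)
    (hgrowth : ∀ u ∈ Vᗮ, ∀ v ∈ V, ‖u‖ ≤ r₀ → ‖v‖ ≤ ε →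
      ((κ * ‖v‖ - ρ / 2 * ‖u‖ ^ 2 : ℝ) : EReal) ≤ F (u + v))
    {δ : ℝ} (hδ : 0 < δ) :
    ∃ r : ℝ, 0 < r ∧ ∀ a ∈ Vᗮ, ∀ b ∈ Vᗮ, ‖a‖ < r → ‖b‖ < r → ∀ va ∈ V, ‖va‖ ≤ ε →
      F (a + va) ≤ (r : EReal) →
      ∃ vb ∈ V, ‖vb‖ ≤ ε ∧ F (b + vb) ≤ F (a + va) + ((δ * ‖b - a‖ : ℝ) : EReal) := by
  obtain ⟨η, hη, hsub⟩ := regSubdiff_norm_ne_near_zero hF hF0 hV hδ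
  set m := min ε (η / 2) with hm
  have hm0 : 0 < m := lt_min hε (by positivity)
  -- The box has radius `R` in `U`; the last two bounds make the loss `ρ/2‖y‖²` in the growth
  -- estimate negligible against `δR` and `κm`.
  obtain ⟨R, hR0, hR1, hR2, hR3, hR4⟩ : ∃ R : ℝ, 0 < R ∧ R < r₀ ∧ R < η / 2 ∧ ρ / 2 * R < δ / 2 ∧
      ρ / 2 * R ^ 2 < κ * m / 2 := by
    have e1 : ∀ᶠ R : ℝ in 𝓝[>] 0, 0 < R := eventually_mem_nhdsWithin
    have e2 : ∀ᶠ R : ℝ in 𝓝[>] 0, R < r₀ := nhdsWithin_le_nhds (gt_mem_nhds hr₀)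
    have e3 : ∀ᶠ R : ℝ in 𝓝[>] 0, R < η / 2 := nhdsWithin_le_nhds (gt_mem_nhds (by positivity))
    have e4 : ∀ᶠ R : ℝ in 𝓝[>] 0, ρ / 2 * R < δ / 2 :=
      nhdsWithin_le_nhds ((Continuous.tendsto' (by fun_prop) (0 : ℝ) 0 (by simp)).eventually
        (gt_mem_nhds (by positivity)))
    have e5 : ∀ᶠ R : ℝ in 𝓝[>] 0, ρ / 2 * R ^ 2 < κ * m / 2 :=
      nhdsWithin_le_nhds ((Continuous.tendsto' (by fun_prop) (0 : ℝ) 0 (by simp)).eventually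
        (gt_mem_nhds (by positivity)))
    exact (e1.and (e2.and (e3.and (e4.and e5)))).exists
  -- `r(1 + 2δ)` bounds the penalized value at `(a, va)`, as `‖a - b‖ < 2r`.
  obtain ⟨r, hr0, hr1, hr2, hr3, hr4⟩ : ∃ r : ℝ, 0 < r ∧ r < R / 4 ∧
      r * (1 + 2 * δ) < κ * m / 2 ∧ r * (1 + 2 * δ) < δ * R / 4 ∧ r * (1 + 2 * δ) < η := by
    have e1 : ∀ᶠ R : ℝ in 𝓝[>] 0, 0 < R := eventually_mem_nhdsWithin
    have e2 : ∀ᶠ r : ℝ in 𝓝[>] 0, r < R / 4 := nhdsWithin_le_nhds (gt_mem_nhds (by positivity))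
    have e3 : ∀ t : ℝ, 0 < t → ∀ᶠ r : ℝ in 𝓝[>] 0, r * (1 + 2 * δ) < t := fun t ht =>
      nhdsWithin_le_nhds ((Continuous.tendsto' (by fun_prop) (0 : ℝ) 0 (by simp)).eventually
        (gt_mem_nhds ht))
    exact (e1.and (e2.and ((e3 _ (by positivity)).and
      ((e3 _ (by positivity)).and (e3 _ hη))))).exists
  refine ⟨r, hr0, fun a haV b hbV ha hb va hva hvaε hFa => ?_⟩
  set K : Set (Vᗮ × V) := Metric.closedBall 0 R ×ˢ Metric.closedBall 0 ε with hK
  have hKc : IsCompact K := (isCompact_closedBall _ _).prod (isCompact_closedBall _ _)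
  set G : Vᗮ × V → EReal := fun p =>
    F ((p.1 : E) + (p.2 : E)) + ((δ * ‖(p.1 : E) - b‖ : ℝ) : EReal) with hG
  have hGlsc : LowerSemicontinuous G :=
    lowerSemicontinuous_add_coe (hF.comp (g := fun p : Vᗮ × V => (p.1 : E) + (p.2 : E))
      (by fun_prop)) (by fun_prop)
  have haK : ((⟨a, haV⟩, ⟨va, hva⟩) : Vᗮ × V) ∈ K := by
    refine ⟨mem_closedBall_zero_iff.2 ?_, mem_closedBall_zero_iff.2 hvaε⟩
    exact (show ‖a‖ ≤ R by linarith)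
  obtain ⟨⟨y, v⟩, hyvK, hmin⟩ := (hGlsc.lowerSemicontinuousOn K).exists_isMinOn ⟨_, haK⟩ hKc
  have hyR : ‖(y : E)‖ ≤ R := mem_closedBall_zero_iff.1 hyvK.1
  have hvε : ‖(v : E)‖ ≤ ε := mem_closedBall_zero_iff.1 hyvK.2
  have hmina : F (y + v) + ((δ * ‖(y : E) - b‖ : ℝ) : EReal) ≤
      F (a + va) + ((δ * ‖a - b‖ : ℝ) : EReal) := hmin haK
  have hmina' : F (y + v) + ((δ * ‖(y : E) - b‖ : ℝ) : EReal) ≤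
      ((r * (1 + 2 * δ) : ℝ) : EReal) := by
    refine hmina.trans ((add_le_add_left hFa _).trans ?_)
    rw [← EReal.coe_add, EReal.coe_le_coe_iff]
    nlinarith [norm_sub_le a b]
  have hg := hgrowth y y.2 v v.2 (hyR.trans hR1.le) hvε
  have hfin : F (y + v) ≠ ⊥ ∧ F (y + v) ≠ ⊤ := by
    constructor
    · intro h; rw [h] at hg; exact EReal.coe_ne_bot _ (le_bot_iff.1 hg)
    · intro h; rw [h] at hmina'
      rw [EReal.top_add_coe] at hmina'
      exact EReal.coe_ne_top _ (top_le_iff.1 hmina')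
  obtain ⟨q, hq⟩ : ∃ q : ℝ, F (y + v) = (q : EReal) :=
    ⟨_, (EReal.coe_toReal hfin.2 hfin.1).symm⟩
  rw [hq] at hmina' hg
  rw [← EReal.coe_add, EReal.coe_le_coe_iff] at hmina'
  rw [EReal.coe_le_coe_iff] at hg
  have hyb0 := norm_nonneg ((y : E) - b)
  have hsq : ρ / 2 * ‖(y : E)‖ ^ 2 < κ * m / 2 ∧ ρ / 2 * ‖(y : E)‖ ^ 2 < δ * R / 2 := by
    have hy2 : ‖(y : E)‖ ^ 2 ≤ R ^ 2 := by gcongr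
    rcases le_total 0 ρ with hρ | hρ
    · have h1 : ρ / 2 * ‖(y : E)‖ ^ 2 ≤ ρ / 2 * R ^ 2 := by gcongr
      constructor
      · linarith
      · nlinarith
    · have h1 : ρ / 2 * ‖(y : E)‖ ^ 2 ≤ 0 := mul_nonpos_of_nonpos_of_nonneg (by linarith) (by positivity)
      constructor
      · have : 0 < κ * m / 2 := by positivity
        linarith
      · have : 0 < δ * R / 2 := by positivity
        linarith
  have hκv : 0 ≤ κ * ‖(v : E)‖ := by positivity
  have hvm : ‖(v : E)‖ < m := by
    refine lt_of_mul_lt_mul_left ?_ hκ.le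
    nlinarith [hsq.1, mul_nonneg hδ.le hyb0]
  -- `δ‖y - b‖` is less than `δR/4 + δR/2`; with `‖b‖ < R/4` this keeps `y` off the boundary of the
  -- box.
  have hyb : ‖(y : E) - b‖ < 3 * R / 4 := by
    refine lt_of_mul_lt_mul_left ?_ hδ.le
    nlinarith [hsq.2]
  have hyR' : ‖(y : E)‖ < R := by
    have := norm_add_le ((y : E) - b) b
    rw [sub_add_cancel] at this
    linarith
  by_cases hyeq : (y : E) = b
  · refine ⟨v, v.2, hvε, ?_⟩
    rw [hyeq, sub_self, norm_zero, mul_zero, EReal.coe_zero, add_zero] at hmina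
    rwa [norm_sub_rev]
  exfalso
  have hproj : Vᗮ.starProjection ((y : E) + v) = y := by
    rw [map_add, Submodule.starProjection_eq_self_iff.2 y.2,
      Submodule.starProjection_orthogonal_apply_eq_zero v.2, add_zero]
  have hprojV : V.starProjection ((y : E) + v) = v := by
    rw [map_add, Submodule.starProjection_eq_self_iff.2 v.2,
      (Submodule.starProjection_apply_eq_zero_iff V).2 y.2, zero_add]
  have hloc : ∀ᶠ z in 𝓝 ((y : E) + v),
      F (y + v) + ((δ * ‖Vᗮ.starProjection ((y : E) + v) - b‖ : ℝ) : EReal) ≤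
        F z + ((δ * ‖Vᗮ.starProjection z - b‖ : ℝ) : EReal) := by
    have c1 : ∀ᶠ z in 𝓝 ((y : E) + v), ‖Vᗮ.starProjection z‖ < R :=
      (Continuous.tendsto (by fun_prop) _).eventually (gt_mem_nhds (by rwa [hproj]))
    have c2 : ∀ᶠ z in 𝓝 ((y : E) + v), ‖V.starProjection z‖ < ε :=
      (Continuous.tendsto (by fun_prop) _).eventually
        (gt_mem_nhds (by rw [hprojV]; exact hvm.trans_le (min_le_left _ _)))
    filter_upwards [c1, c2] with z hz1 hz2
    have hzK : ((⟨_, Vᗮ.starProjection_apply_mem z⟩, ⟨_, V.starProjection_apply_mem z⟩) :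
        Vᗮ × V) ∈ K :=
      ⟨mem_closedBall_zero_iff.2 hz1.le, mem_closedBall_zero_iff.2 hz2.le⟩
    have := hmin hzK
    simp only [hG, Set.mem_ofPred_eq] at this
    rw [add_comm (Vᗮ.starProjection z), V.starProjection_add_starProjection_orthogonal] at this
    rwa [hproj]
  have hne : Vᗮ.starProjection ((y : E) + v) - b ≠ 0 := by
    rw [hproj]; exact sub_ne_zero.2 hyeq
  have hsubg := mem_regSubdiff_of_isLocalMin_add_norm F Vᗮ hbV hδ hfin hne hloc
  rw [hproj] at hsubg hne
  refine hsub _ ?_ ?_ _ hsubg (Vᗮ.smul_mem _ (Vᗮ.sub_mem y.2 hbV)) ?_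
  · calc ‖(y : E) + v‖ ≤ ‖(y : E)‖ + ‖(v : E)‖ := norm_add_le _ _
      _ < η / 2 + η / 2 := add_lt_add (hyR'.trans hR2) (hvm.trans_le (min_le_right _ _))
      _ = η := by ring
  · rw [hq, EReal.coe_lt_coe_iff]
    nlinarith
  · have h0 : ‖(y : E) - b‖ ≠ 0 := norm_ne_zero_iff.2 hne
    rw [norm_smul, norm_neg, Real.norm_of_nonneg (by positivity), div_mul_cancel₀ _ h0]

end Abstract

/-! ### The partial infimum and strict differentiability -/

theorem biInf_add_coe {ι : Type*} (s : Set ι) (g : ι → EReal) (r : ℝ) :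
    (⨅ i ∈ s, (g i + (r : EReal))) = (⨅ i ∈ s, g i) + (r : EReal) := by
  refine le_antisymm ?_ (le_iInf₂ fun i hi => by gcongr; exact iInf₂_le i hi)
  rw [← neg_neg r, ← ereal_add_coe_le_iff, neg_neg]
  refine le_iInf₂ fun i hi => ?_
  rw [ereal_add_coe_le_iff, neg_neg]
  exact iInf₂_le i hi

section Abstract

variable {E : Type*} [NormedAddCommGroup E] [InnerProductSpace ℝ E]

/-- Partial minimization over a ball of `V` of a function with linear growth along `V` gives a
function that is finite near `0` and Lipschitz with arbitrarily small modulus. -/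
theorem biInf_finite_and_lipschitz_of_growth [FiniteDimensional ℝ E] {F : E → EReal}
    (hF : LowerSemicontinuous F) (hF0 : F 0 = 0) {V : Submodule ℝ E}
    (hV : limSubdiff F 0 ⊆ V)
    {ε κ ρ r₀ : ℝ} (hε : 0 < ε) (hκ : 0 < κ) (hr₀ : 0 < r₀)
    (hgrowth : ∀ u ∈ Vᗮ, ∀ v ∈ V, ‖u‖ ≤ r₀ → ‖v‖ ≤ ε →
      ((κ * ‖v‖ - ρ / 2 * ‖u‖ ^ 2 : ℝ) : EReal) ≤ F (u + v))
    {φ : Vᗮ → EReal}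
    (hφ : ∀ u : Vᗮ, φ u = ⨅ v ∈ Metric.closedBall (0 : V) ε, F (u + v))
    {δ : ℝ} (hδ : 0 < δ) :
    ∃ r : ℝ, 0 < r ∧ ∀ u : Vᗮ, ‖u‖ < r → FiniteAt φ u ∧
      ∀ w : Vᗮ, ‖w‖ < r → φ w ≤ φ u + ((δ * ‖w - u‖ : ℝ) : EReal) := by
  obtain ⟨r, hr, hstep⟩ := exists_le_add_of_growth hF hF0 hV hε hκ hr₀ hgrowth hδ
  -- The factor `1 + δ` ensures `δ‖u‖ < r`, hence `φ u < r`, so near-minimizers satisfy the level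
  -- condition of `hstep`.
  refine ⟨min r₀ (r / (1 + δ)), lt_min hr₀ (by positivity), fun u hu => ?_⟩
  have hlt : ∀ w : Vᗮ, ‖w‖ < min r₀ (r / (1 + δ)) → ‖(w : E)‖ < r := fun w hw => by
    refine (hw.trans_le (min_le_right _ _)).trans_le (div_le_self hr.le (by linarith))
  have hle : φ u ≤ ((δ * ‖u‖ : ℝ) : EReal) := by
    obtain ⟨v, hvV, hvε, hv⟩ := hstep 0 (zero_mem _) u u.2 (by simpa using hr) (hlt u hu) 0
      (zero_mem _) (by simpa using hε.le) (by simpa [hF0] using hr.le)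
    rw [add_zero, hF0, zero_add, sub_zero] at hv
    rw [hφ]
    exact (iInf₂_le (⟨v, hvV⟩ : V) (mem_closedBall_zero_iff.2 hvε)).trans hv
  have hge : ((- (ρ / 2 * ‖u‖ ^ 2) : ℝ) : EReal) ≤ φ u := by
    rw [hφ]
    refine le_iInf₂ fun v hv => ?_
    refine le_trans ?_ (hgrowth u u.2 v v.2 (hu.trans_le (min_le_left _ _)).le
      (mem_closedBall_zero_iff.1 hv))
    rw [EReal.coe_le_coe_iff, Submodule.coe_norm]
    linarith [mul_nonneg hκ.le (norm_nonneg (v : E))]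
  have hur : φ u < (r : EReal) := by
    refine hle.trans_lt (EReal.coe_lt_coe_iff.2 ?_)
    have := hu.trans_le (min_le_right _ _)
    rw [lt_div_iff₀ (by positivity)] at this
    linarith [norm_nonneg u]
  refine ⟨⟨fun h => ?_, fun h => ?_⟩, fun w hw => ?_⟩
  · rw [h] at hge
    exact EReal.coe_ne_bot _ (le_bot_iff.1 hge)
  · rw [h] at hle
    exact EReal.coe_ne_top _ (top_le_iff.1 hle)
  rw [← neg_neg (δ * ‖w - u‖), ← ereal_add_coe_le_iff]
  refine le_of_forall_gt_imp_ge_of_dense fun c hc => ?_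
  have hlt' : φ u < min c (r : EReal) := lt_min hc hur
  rw [hφ u] at hlt'
  simp only [iInf_lt_iff] at hlt'
  obtain ⟨v, hv, hvlt⟩ := hlt'
  obtain ⟨z, hzV, hzε, hz⟩ := hstep u u.2 w w.2 (hlt u hu) (hlt w hw) v v.2
    (mem_closedBall_zero_iff.1 hv) (hvlt.trans_le (min_le_right _ _)).le
  rw [ereal_add_coe_le_iff, neg_neg, hφ w]
  calc (⨅ v ∈ Metric.closedBall (0 : V) ε, F (w + v)) ≤ F (w + z) :=
        iInf₂_le (⟨z, hzV⟩ : V) (mem_closedBall_zero_iff.2 hzε)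
    _ ≤ F (u + v) + ((δ * ‖w - u‖ : ℝ) : EReal) := hz
    _ ≤ c + ((δ * ‖w - u‖ : ℝ) : EReal) := by
        gcongr
        exact (hvlt.trans_le (min_le_left _ _)).le

/-- Exchanging `u` and `w` turns the one-sided bound into `|φ w - φ u| ≤ δ‖w - u‖`, so `φ` has
strict derivative `0`. -/
theorem strictlyDifferentiableWithGradient_add_affine {L φ : E → EReal} {g : E} {c : ℝ}
    (hL : ∀ u, L u = φ u + ((c + inner ℝ g u : ℝ) : EReal))
    (hφ : ∀ δ : ℝ, 0 < δ → ∃ r : ℝ, 0 < r ∧ ∀ u : E, ‖u‖ < r → FiniteAt φ u ∧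
      ∀ w : E, ‖w‖ < r → φ w ≤ φ u + ((δ * ‖w - u‖ : ℝ) : EReal)) :
    StrictlyDifferentiableWithGradient L g 0 := by
  refine ⟨?_, .of_isLittleO (Asymptotics.isLittleO_iff.2 fun δ hδ => ?_)⟩
  · obtain ⟨r, hr, h⟩ := hφ 1 one_pos
    filter_upwards [Metric.ball_mem_nhds (0 : E) hr] with u hu
    obtain ⟨h1, h2⟩ := (h u (mem_ball_zero_iff.1 hu)).1
    rw [FiniteAt, hL]
    lift φ u to ℝ using ⟨h2, h1⟩ with q
    rw [← EReal.coe_add]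
    exact ⟨EReal.coe_ne_bot _, EReal.coe_ne_top _⟩
  · obtain ⟨r, hr, h⟩ := hφ δ hδ
    have hb := Metric.ball_mem_nhds (0 : E) hr
    filter_upwards [prod_mem_nhds hb hb] with p hp
    have h1 := mem_ball_zero_iff.1 hp.1
    have h2 := mem_ball_zero_iff.1 hp.2
    obtain ⟨⟨a1, a2⟩, ha⟩ := h _ h1
    obtain ⟨⟨b1, b2⟩, hb⟩ := h _ h2
    have ha := ha _ h2
    have hb := hb _ h1
    rw [hL, hL]
    lift φ p.1 to ℝ using ⟨a2, a1⟩ with q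
    lift φ p.2 to ℝ using ⟨b2, b1⟩ with q'
    simp only [← EReal.coe_add, EReal.coe_le_coe_iff, EReal.toReal_coe] at *
    rw [norm_sub_rev] at ha
    rw [innerSL_apply_apply, inner_sub_right, Real.norm_eq_abs, abs_le]
    constructor <;> linarith

/-! ### Tilting and linear growth along `V` -/

/-- The translate of `f` by `x₀`, minus its value there and minus the linear function `g`. -/
def tilt (f : E → EReal) (x₀ g : E) (x : E) : EReal :=
  f (x₀ + x) + ((-(f x₀).toReal - inner ℝ g x : ℝ) : EReal)

theorem lowerSemicontinuous_tilt {f : E → EReal} (hf : LowerSemicontinuous f) (x₀ g : E) :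
    LowerSemicontinuous (tilt f x₀ g) :=
  lowerSemicontinuous_add_coe (hf.comp (g := fun x => x₀ + x) (by fun_prop)) (by fun_prop)

theorem tilt_zero {f : E → EReal} {x₀ : E} (h : FiniteAt f x₀) (g : E) : tilt f x₀ g 0 = 0 := by
  rw [tilt, add_zero, inner_zero_right, sub_zero]
  obtain ⟨h1, h2⟩ := h
  lift f x₀ to ℝ using ⟨h2, h1⟩ with q
  rw [EReal.toReal_coe, ← EReal.coe_add, add_neg_cancel, EReal.coe_zero]

theorem eq_tilt_add (f : E → EReal) (x₀ g x : E) :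
    f (x₀ + x) = tilt f x₀ g x + (((f x₀).toReal + inner ℝ g x : ℝ) : EReal) := by
  rw [tilt, add_assoc, ← EReal.coe_add]
  rw [show -(f x₀).toReal - inner ℝ g x + ((f x₀).toReal + inner ℝ g x) = 0 by ring,
    EReal.coe_zero, add_zero]

theorem add_mem_regSubdiff_of_tilt {f : E → EReal} {x₀ g x s : E}
    (hs : s ∈ regSubdiff (tilt f x₀ g) x) : s + g ∈ regSubdiff f (x₀ + x) := by
  obtain ⟨⟨h1, h2⟩, h⟩ := hs
  refine ⟨?_, fun δ hδ => ?_⟩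
  · rw [FiniteAt, eq_tilt_add f x₀ g x]
    lift tilt f x₀ g x to ℝ using ⟨h2, h1⟩ with q
    rw [← EReal.coe_add]
    exact ⟨EReal.coe_ne_bot _, EReal.coe_ne_top _⟩
  · have ht : Tendsto (fun y => y - x₀) (𝓝 (x₀ + x)) (𝓝 x) :=
      Continuous.tendsto' (by fun_prop) _ _ (by abel)
    filter_upwards [ht.eventually (h δ hδ)] with y hy
    have e1 : f y = tilt f x₀ g (y - x₀) +
        (((f x₀).toReal + inner ℝ g (y - x₀) : ℝ) : EReal) := by
      rw [← eq_tilt_add, add_sub_cancel]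
    rw [e1, eq_tilt_add f x₀ g x, add_assoc]
    have e2 : y - (x₀ + x) = y - x₀ - x := by abel
    refine le_trans (le_of_eq ?_)
      (add_le_add_left hy (((f x₀).toReal + inner ℝ g (y - x₀) : ℝ) : EReal))
    rw [add_assoc, ← EReal.coe_add, ← EReal.coe_add, e2]
    congr 2
    rw [inner_add_left, inner_sub_right g (y - x₀) x]
    ring

theorem add_mem_limSubdiff_of_tilt {f : E → EReal} {x₀ g s : E} (hx₀ : FiniteAt f x₀)
    (hs : s ∈ limSubdiff (tilt f x₀ g) 0) : s + g ∈ limSubdiff f x₀ := by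
  obtain ⟨-, xs, ss, hx, hF, hss, hlim⟩ := hs
  refine ⟨hx₀, fun k => x₀ + xs k, fun k => ss k + g, ?_, ?_,
    fun k => add_mem_regSubdiff_of_tilt (hss k), hlim.add_const g⟩
  · simpa using hx.const_add x₀
  · have h1 : Tendsto (fun k => (((f x₀).toReal + inner ℝ g (xs k) : ℝ) : EReal)) atTop
        (𝓝 (((f x₀).toReal + inner ℝ g 0 : ℝ) : EReal)) :=
      ((continuous_coe_real_ereal.comp
        (show Continuous fun x => (f x₀).toReal + inner ℝ g x by fun_prop)).tendsto 0).comp hx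
    have h2 := (EReal.continuousAt_add (Or.inr (EReal.coe_ne_bot _))
      (Or.inr (EReal.coe_ne_top _))).tendsto.comp (hF.prodMk_nhds h1)
    rw [← eq_tilt_add, add_zero] at h2
    refine h2.congr fun k => ?_
    simp only [Function.comp, ← eq_tilt_add]

/-- The linear growth along `V` of `f` tilted by a relative interior subgradient. -/
theorem tilt_growth {f : E → EReal} {x₀ g : E} {V : Submodule ℝ E} {ε ε' ρ : ℝ}
    (hfin : FiniteAt f x₀) (hprox : ∀ s ∈ limSubdiff f x₀, ProxRegularWith f x₀ s ε' ρ)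
    (hρ0 : 0 ≤ ρ) (hρ2 : ρ < 2) (hε : 0 < ε) (hε' : ε < ε')
    (hg : ∀ w ∈ V, ‖w‖ < ε → g + w ∈ limSubdiff f x₀) {u v : E} (hu : u ∈ Vᗮ) (hv : v ∈ V)
    (hur : ‖u‖ ≤ ε' - ε) (hvε : ‖v‖ ≤ ε) :
    ((ε * (2 - ρ) / 4 * ‖v‖ - ρ / 2 * ‖u‖ ^ 2 : ℝ) : EReal) ≤ tilt f x₀ g (u + v) := by
  -- The midpoint of `ρε/2` and `ε`: below `ε`, so `g + w` is a subgradient, and with `t - ρε/2 =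
  -- ε(2 - ρ)/4 > 0`, where `ρ < 2` enters.
  set t := ε * (2 + ρ) / 4 with ht
  have ht0 : 0 < t := by positivity
  have htε : t < ε := by nlinarith
  set w := (t / ‖v‖) • v with hw
  have hwn : ‖w‖ ≤ t := by
    rw [hw, norm_smul, Real.norm_of_nonneg (by positivity)]
    rcases eq_or_ne ‖v‖ 0 with h | h
    · simpa [h] using ht0.le
    · rw [div_mul_cancel₀ _ h]
  have hwv : inner ℝ w v = t * ‖v‖ := by
    rw [hw, real_inner_smul_left, real_inner_self_eq_norm_sq]
    rcases eq_or_ne ‖v‖ 0 with h | h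
    · simp [h]
    · field_simp
  have hwu : inner ℝ w u = 0 := V.inner_right_of_mem_orthogonal (V.smul_mem _ hv) hu
  have hmem := hg w (V.smul_mem _ hv) (hwn.trans_lt htε)
  have hsq : ‖u + v‖ ^ 2 = ‖u‖ ^ 2 + ‖v‖ ^ 2 := by
    rw [norm_add_sq_real, V.inner_left_of_mem_orthogonal hv hu]; ring
  have hε'0 : 0 < ε' := hε.trans hε'
  obtain ⟨h1, h2⟩ := hfin
  have hlt : f x₀ < f x₀ + (ε' : EReal) := by
    lift f x₀ to ℝ using ⟨h2, h1⟩ with q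
    rw [← EReal.coe_add, EReal.coe_lt_coe_iff]
    linarith
  have hx' : x₀ + (u + v) ∈ Metric.closedBall x₀ ε' := by
    rw [mem_closedBall_iff_norm, add_sub_cancel_left]
    linarith [norm_add_le u v]
  have key := (hprox _ hmem).2.2.2.2.2 x₀ _ hmem (by simpa using hε'0) (by simpa using hε'0) hlt
    _ hx'
  rw [add_sub_cancel_left] at key
  rw [tilt, ← neg_neg (-(f x₀).toReal - _), ← ereal_add_coe_le_iff]
  refine le_trans ?_ key
  lift f x₀ to ℝ using ⟨h2, h1⟩ with q
  rw [EReal.toReal_coe, ← EReal.coe_add, ← EReal.coe_add, EReal.coe_le_coe_iff, hsq,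
    inner_add_left, inner_add_right w, hwu, hwv]
  -- The term `ρ/2‖v‖²` is absorbed through `‖v‖² ≤ ε‖v‖`.
  nlinarith [mul_nonneg (mul_nonneg hρ0 (norm_nonneg v)) (sub_nonneg.2 hvε)]

end Abstract

end ULag

end

/-! ### The theorem -/

theorem mainTheorem1 (n : ℕ) (f : EuclideanSpace ℝ (Fin n) → EReal)
    (xbar : EuclideanSpace ℝ (Fin n)) (ε εbar ρ : ℝ)
    (hproper : ULag.IsProper f) (hlsc : LowerSemicontinuous f)
    (hprox : ULag.ProperlyProxRegularWith f xbar εbar ρ)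
    (hρ0 : 0 < ρ) (hρ2 : ρ < 2) (hε : 0 < ε) (hεbar : ε < εbar)
    (gbar : EuclideanSpace ℝ (Fin n)) (hgbar : gbar ∈ ULag.epsRelInterior f xbar ε) :
    ULag.StrictlyDifferentiableWithGradient
      (ULag.uLagrangian f xbar ε ((ULag.spaceV f xbar).orthogonalProjectionOnto gbar))
      ((ULag.spaceU f xbar).orthogonalProjectionOnto gbar) 0 := by
  have hgmem : gbar ∈ ULag.limSubdiff f xbar := by
    simpa using hgbar 0 (zero_mem _) (by simpa using hε)
  have hfin : ULag.FiniteAt f xbar := hgmem.1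
  have hV : ULag.limSubdiff (ULag.tilt f xbar gbar) 0 ⊆ ULag.spaceV f xbar := fun s hs => by
    have := vsub_mem_vectorSpan ℝ (ULag.add_mem_limSubdiff_of_tilt hfin hs) hgmem
    rwa [vsub_eq_sub, add_sub_cancel_right] at this
  refine ULag.strictlyDifferentiableWithGradient_add_affine (c := (f xbar).toReal)
    (φ := fun u : ULag.spaceU f xbar => ⨅ v ∈ Metric.closedBall (0 : ULag.spaceV f xbar) ε,
      ULag.tilt f xbar gbar ((u : EuclideanSpace ℝ (Fin n)) + v)) (fun u => ?_) fun δ hδ =>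
    ULag.biInf_finite_and_lipschitz_of_growth (ULag.lowerSemicontinuous_tilt hlsc xbar gbar)
      (ULag.tilt_zero hfin gbar) hV hε (κ := ε * (2 - ρ) / 4) (ρ := ρ)
      (by have := sub_pos.2 hρ2; positivity) (sub_pos.2 hεbar)
      (fun u hu v hv hur hvε =>
        ULag.tilt_growth hfin hprox.1 hρ0.le hρ2 hε hεbar hgbar hu hv hur hvε) (fun _ => rfl) hδ
  -- The integrands agree because `⟨gbar, u + v⟩ - ⟨gbar_v, v⟩ = ⟨gbar_u, u⟩`.
  rw [← ULag.biInf_add_coe, ULag.uLagrangian]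
  refine iInf_congr fun v => iInf_congr fun _ => ?_
  rw [add_assoc, ULag.eq_tilt_add f xbar gbar, sub_eq_add_neg, ← EReal.coe_neg, add_assoc,
    ← EReal.coe_add, Submodule.inner_orthogonalProjectionOnto_eq_of_mem_right,
    Submodule.inner_orthogonalProjectionOnto_eq_of_mem_right, inner_add_right]
  congr 2
  ring
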